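/- Consider the $A$-armed stochastic bandit with optional reward queries. An instance is $\underline\nu=(\nu_a)_{a=1}^A$, where each $\nu_a$ is an arbitrary probability distribution on $[0,1]$ with mean $r(a)$. Let $U_0,U_1,\dots$ be i.i.d. uniform on $[0,1]$ (internal randomization). In round $t\ge 1$ the strategy $\pi$ chooses an arm $a_t\in\{1,\dots,A\}$ and a query decision $q_t\in\{0,1\}$ as measurable functions of $I_{t-1}=(U_0,Y_1,U_1,\dots,Y_{t-1},U_{t-1})$; then a reward $R_t$ is drawn from $\nu_{a_t}$, with $R_t$ and $U_t$ independent given $I_{t-1}$, and the strategy observes $Y_t=R_t q_t$. For costs $c(1),\dots,c(A)\ge 0$ let $$B^q(T)=\sum_{t=1}^T c(a_t)\mathbf 1\{q_t=1\},\qquad \mathrm{Reg}(T)=\sum_{t=1}^T\Bigl(\max_{a} r(a)-r(a_t)\Bigr).$$ **Proposition.** Let $A\ge 2$, let $T\in\mathbb N$ be the time horizon, let $c(1),\dots,c(A)\ge 0$ be arm-dependent querying costs, and let $B\in\mathbb R$. Let $\pi$ be a bandit strategy such that $\mathbb E_{\underline\nu}[B^q(T)]\le B$ for every bandit instance $\underline\nu$.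 Then there exists a bandit instance $\underline\nu$ for which $$\mathbb E_{\underline\nu}[\mathrm{Reg}(T)]\ \ge\ \frac1{140}\min\left\{T\sqrt{\frac{\sum_{a=1}^A c(a)}{B\,(1+\log A)}},\ T\right\},$$ where $\log$ is the natural logarithm. (The assumption forces $B\ge 0$. For $B=0$ the right-hand side is read as $T/140$ if $\sum_a c(a)>0$, and as $0$ if all costs are $0$.) -/

import Mathlib

open MeasureTheory ProbabilityTheory
open scoped unitInterval

namespace BudgetedBandit

/-- A bandit instance with `A` arms: one reward distribution on `[0,1]` per arm. -/
abbrev Instance (A : ℕ) : Type := Fin A → ProbabilityMeasure I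

/-- The information `I_t = (U_0, Y_1, U_1, …, Y_t, U_t)` available after `t` rounds; the pair added
at round `t + 1` is `(Y_{t+1}, U_{t+1})`. -/
def Info : ℕ → Type
  | 0 => I
  | t + 1 => Info t × (I × I)

instance instMeasurableSpaceInfo : (t : ℕ) → MeasurableSpace (Info t)
  | 0 => inferInstanceAs (MeasurableSpace I)
  | t + 1 =>
    haveI := instMeasurableSpaceInfo t
    inferInstanceAs (MeasurableSpace (Info t × (I × I)))

/-- A (randomized) strategy with querying: the arm `a_{t+1} = arm t I_t` and the query decision
`q_{t+1} = query t I_t` are measurable functions of the information after `t` rounds. -/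
structure Strategy (A : ℕ) where
  arm : (t : ℕ) → Info t → Fin A
  query : (t : ℕ) → Info t → Bool
  measurable_arm : ∀ t, Measurable (arm t)
  measurable_query : ∀ t, Measurable (query t)

variable {A : ℕ}

/-- The mean reward `r(a)` of arm `a`. -/
noncomputable def mean (ν : Instance A) (a : Fin A) : ℝ :=
  ∫ x : I, (x : ℝ) ∂(ν a : Measure I)

/-- The observation `Y = R · q` made when the reward is `R = r` and the query decision is `q`. -/
def observe (q : Bool) (r : I) : I := if q then r else 0

theorem measurable_observe (q : Bool) : Measurable (observe q) := by
  cases q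
  · exact measurable_const
  · exact measurable_id

/-- The law of `(Y, U)` in a round with arm `a` and query decision `q`: `Y = R · q` with
`R ∼ ν a`, and `U` is an independent uniform variable on `[0,1]`. -/
noncomputable def feedback (ν : Instance A) : Kernel (Fin A × Bool) (I × I) :=
  Kernel.ofFunOfCountable fun p =>
    ((ν p.1 : Measure I).map (observe p.2)).prod (volume : Measure I)

instance instIsMarkovKernelFeedback (ν : Instance A) : IsMarkovKernel (feedback ν) :=
  ⟨fun p => by
    haveI : IsProbabilityMeasure ((ν p.1 : Measure I).map (observe p.2)) :=
      Measure.isProbabilityMeasure_map (measurable_observe p.2).aemeasurable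
    change IsProbabilityMeasure
      (((ν p.1 : Measure I).map (observe p.2)).prod (volume : Measure I))
    infer_instance⟩

/-- The conditional law of `(Y_{t+1}, U_{t+1})` given `I_t`. -/
noncomputable def step (ν : Instance A) (π : Strategy A) (t : ℕ) : Kernel (Info t) (I × I) :=
  (feedback ν).comap (fun h => (π.arm t h, π.query t h))
    ((π.measurable_arm t).prodMk (π.measurable_query t))

instance instIsMarkovKernelStep (ν : Instance A) (π : Strategy A) (t : ℕ) :
    IsMarkovKernel (step ν π t) := by
  unfold step; infer_instance

/-- The law of `I_t` when the strategy `π` plays on the instance `ν`: `U_0` is uniform on `[0,1]`,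
and `(Y_{t+1}, U_{t+1})` is drawn from `step ν π t` given `I_t`. -/
noncomputable def law (ν : Instance A) (π : Strategy A) : (t : ℕ) → Measure (Info t)
  | 0 => (volume : Measure I)
  | t + 1 => law ν π t ⊗ₘ step ν π t

instance instIsProbabilityMeasureLaw (ν : Instance A) (π : Strategy A) :
    (t : ℕ) → IsProbabilityMeasure (law ν π t)
  | 0 => inferInstanceAs (IsProbabilityMeasure (volume : Measure I))
  | t + 1 =>
    haveI := instIsProbabilityMeasureLaw ν π t
    inferInstanceAs (IsProbabilityMeasure (law ν π t ⊗ₘ step ν π t))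

/-- The querying cost `B^q(t) = ∑_{k ≤ t} c(a_k) 1{q_k = 1}` spent in the first `t` rounds. -/
def queryCost (c : Fin A → ℝ) (π : Strategy A) : (t : ℕ) → Info t → ℝ
  | 0, _ => 0
  | t + 1, (h, _) => queryCost c π t h + if π.query t h then c (π.arm t h) else 0

/-- The pseudo-regret `Reg(t) = ∑_{k ≤ t} (max_a r(a) - r(a_k))` of the first `t` rounds. -/
noncomputable def regret (ν : Instance A) (π : Strategy A) : (t : ℕ) → Info t → ℝ
  | 0, _ => 0
  | t + 1, (h, _) => regret ν π t h + ((⨆ a, mean ν a) - mean ν (π.arm t h))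

/-- `𝔼_ν[B^q(T)]`. -/
noncomputable def expectedQueryCost (c : Fin A → ℝ) (ν : Instance A) (π : Strategy A) (T : ℕ) : ℝ :=
  ∫ h, queryCost c π T h ∂(law ν π T)

/-- `𝔼_ν[Reg(T)]`. -/
noncomputable def expectedRegret (ν : Instance A) (π : Strategy A) (T : ℕ) : ℝ :=
  ∫ h, regret ν π T h ∂(law ν π T)

/-- A sum over rounds of a function of the chosen arm and query decision is bounded and measurable,
hence integrable; so the two expectations above are genuine. -/
theorem integrable_of_recursion (ν : Instance A) (π : Strategy A) (f : (t : ℕ) → Info t → ℝ)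
    (g : Fin A × Bool → ℝ) (h0 : ∀ h, f 0 h = 0)
    (hs : ∀ t h y, f (t + 1) (h, y) = f t h + g (π.arm t h, π.query t h)) (t : ℕ) :
    Integrable (f t) (law ν π t) := by
  have hm : ∀ t, Measurable (f t) := by
    intro t
    induction t with
    | zero => rw [show f 0 = fun _ => 0 from funext h0]; exact measurable_const
    | succ t ih =>
      have : f (t + 1) = fun p : Info t × (I × I) =>
          f t p.1 + g (π.arm t p.1, π.query t p.1) := funext fun p => hs t p.1 p.2
      rw [this]
      exact (ih.comp measurable_fst).add ((measurable_of_countable g).comp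
        (((π.measurable_arm t).comp measurable_fst).prodMk
          ((π.measurable_query t).comp measurable_fst)))
  have hb : ∀ t, ∃ C : ℝ, ∀ h, ‖f t h‖ ≤ C := by
    intro t
    induction t with
    | zero => exact ⟨0, fun h => by rw [h0]; simp⟩
    | succ t ih =>
      obtain ⟨C, hC⟩ := ih
      refine ⟨C + ∑ p, ‖g p‖, fun p => ?_⟩
      obtain ⟨h, y⟩ := p
      rw [hs]
      exact (norm_add_le _ _).trans (add_le_add (hC h)
        (Finset.single_le_sum (f := fun p => ‖g p‖) (fun _ _ => norm_nonneg _)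
          (Finset.mem_univ _)))
  obtain ⟨C, hC⟩ := hb t
  exact Integrable.of_bound (hm t).aestronglyMeasurable C (Filter.Eventually.of_forall hC)

theorem integrable_queryCost (c : Fin A → ℝ) (ν : Instance A) (π : Strategy A) (t : ℕ) :
    Integrable (queryCost c π t) (law ν π t) :=
  integrable_of_recursion ν π (queryCost c π) (fun p => if p.2 then c p.1 else 0)
    (fun _ => rfl) (fun _ _ _ => rfl) t

theorem integrable_regret (ν : Instance A) (π : Strategy A) (t : ℕ) :
    Integrable (regret ν π t) (law ν π t) :=
  integrable_of_recursion ν π (regret ν π) (fun p => (⨆ a, mean ν a) - mean ν p.1)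
    (fun _ => rfl) (fun _ _ _ => rfl) t

end BudgetedBandit

namespace BudgetedBandit

variable {A : ℕ}

/-! On the instance `fair` the budget reads `∑ a, c a * E[queries a] ≤ B`. If `s ^ 2 * B ≤ ∑ a, c
a`, averaging with weights `c` yields an arm `a` with `s ^ 2 * E[queries a] ≤ 1`: too few queries to
detect a shift of its mean by `s / 16`. The divergence from `fair` to the shifted instance is at
most `1 / 64`, so by a Pinsker-type bound the expected number of plays of `a` moves by at most `T /
4`. If `fair` plays `a` at most `T / 2` times on average, raise its mean; otherwise lower it. Either
way at least `T / 4` plays are expected to be wrong, so the regret is at least `s * T / 64`.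

The argument rests on `law_perturbed` (change of measure), `integral_logRatio_ge` (divergence),
`abs_exp_sub_one_le` (Pinsker substitute) and `exists_expectedRegret_ge` (choice of instance). The
constant `1 / 64` beats `1 / 140`, and the factor `1 + log A` is not needed. -/

/-! ### Bernoulli instances -/

/-- The Bernoulli distribution with parameter `p`, as a distribution on `[0,1]`. -/
noncomputable def bernoulli (p : I) : ProbabilityMeasure I :=
  ⟨ENNReal.ofReal p • Measure.dirac 1 + ENNReal.ofReal (1 - p) • Measure.dirac 0, ⟨by
    simp only [Measure.coe_add, Measure.coe_smul, Pi.add_apply, Pi.smul_apply, measure_univ,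
      smul_eq_mul, mul_one]
    rw [← ENNReal.ofReal_add p.2.1 (sub_nonneg.2 p.2.2)]
    simp⟩⟩

theorem coe_bernoulli (p : I) : (bernoulli p : Measure I) =
    ENNReal.ofReal p • Measure.dirac 1 + ENNReal.ofReal (1 - p) • Measure.dirac 0 := rfl

theorem lintegral_bernoulli (p : I) (f : I → ENNReal) :
    ∫⁻ x, f x ∂(bernoulli p : Measure I) =
      ENNReal.ofReal p * f 1 + ENNReal.ofReal (1 - p) * f 0 := by
  rw [coe_bernoulli, lintegral_add_measure, lintegral_smul_measure, lintegral_smul_measure,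
    lintegral_dirac, lintegral_dirac]
  rfl

theorem integral_bernoulli (p : I) (f : I → ℝ) :
    ∫ x, f x ∂(bernoulli p : Measure I) = p * f 1 + (1 - p) * f 0 := by
  rw [coe_bernoulli, integral_add_measure, integral_smul_measure, integral_smul_measure,
    integral_dirac, integral_dirac, ENNReal.toReal_ofReal p.2.1,
    ENNReal.toReal_ofReal (sub_nonneg.2 p.2.2)]
  · simp
  · exact (integrable_dirac (by simp)).smul_measure ENNReal.ofReal_ne_top
  · exact (integrable_dirac (by simp)).smul_measure ENNReal.ofReal_ne_top

/-- The point `1/2` of the unit interval. -/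
noncomputable def half : I := ⟨1 / 2, by norm_num, by norm_num⟩

/-- Arm `a` is Bernoulli with parameter `p`; all other arms are Bernoulli with parameter `1/2`. -/
noncomputable def perturbed (a : Fin A) (p : I) : Instance A :=
  fun i => bernoulli (if i = a then p else half)

/-- All arms are Bernoulli with parameter `1/2`. -/
noncomputable def fair : Instance A := fun _ => bernoulli half

theorem mean_perturbed (a : Fin A) (p : I) (i : Fin A) :
    mean (perturbed a p) i = if i = a then (p : ℝ) else 1 / 2 := by
  rw [mean, perturbed, integral_bernoulli]
  split_ifs <;> simp [half]

/-! ### Cost and regret in terms of play and query counts -/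

/-- The number of rounds in which arm `a` is chosen. -/
def plays (a : Fin A) (π : Strategy A) : (t : ℕ) → Info t → ℝ
  | 0, _ => 0
  | t + 1, (h, _) => plays a π t h + if π.arm t h = a then 1 else 0

/-- The number of rounds in which arm `a` is chosen and queried. -/
def queries (a : Fin A) (π : Strategy A) : (t : ℕ) → Info t → ℝ
  | 0, _ => 0
  | t + 1, (h, _) => queries a π t h + if (π.arm t h, π.query t h) = (a, true) then 1 else 0

theorem integrable_plays (ν : Instance A) (a : Fin A) (π : Strategy A) (t : ℕ) :
    Integrable (plays a π t) (law ν π t) :=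
  integrable_of_recursion ν π (plays a π) (fun p => if p.1 = a then 1 else 0)
    (fun _ => rfl) (fun _ _ _ => rfl) t

theorem integrable_queries (ν : Instance A) (a : Fin A) (π : Strategy A) (t : ℕ) :
    Integrable (queries a π t) (law ν π t) :=
  integrable_of_recursion ν π (queries a π) (fun p => if p = (a, true) then 1 else 0)
    (fun _ => rfl) (fun _ _ _ => rfl) t

theorem plays_mem (a : Fin A) (π : Strategy A) (t : ℕ) (h : Info t) :
    0 ≤ plays a π t h ∧ plays a π t h ≤ t := by
  induction t with
  | zero => simp [plays]
  | succ t ih =>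
    obtain ⟨h, y⟩ := h
    have := ih h
    simp only [plays]
    push_cast
    split_ifs <;> constructor <;> linarith

theorem queryCost_eq_sum (c : Fin A → ℝ) (π : Strategy A) (t : ℕ) (h : Info t) :
    queryCost c π t h = ∑ a, c a * queries a π t h := by
  induction t with
  | zero => simp [queryCost, queries]
  | succ t ih =>
    obtain ⟨h, y⟩ := h
    simp only [queryCost, queries, ih h, mul_add, Finset.sum_add_distrib]
    congr 1
    cases π.query t h <;> simp

theorem expectedQueryCost_eq_sum (c : Fin A → ℝ) (ν : Instance A) (π : Strategy A) (T : ℕ) :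
    expectedQueryCost c ν π T = ∑ a, c a * ∫ h, queries a π T h ∂(law ν π T) := by
  simp_rw [expectedQueryCost, queryCost_eq_sum]
  rw [integral_finsetSum _ fun a _ => (integrable_queries ν a π T).const_mul (c a)]
  simp_rw [integral_const_mul]

/-- `2 ≤ A` supplies an arm other than `a`, where the value `1 / 2` is attained. -/
theorem iSup_mean_perturbed (hA : 2 ≤ A) (a : Fin A) (p : I) :
    ⨆ i, mean (perturbed a p) i = max (p : ℝ) (1 / 2) := by
  have : Nontrivial (Fin A) := Fin.nontrivial_iff_two_le.2 hA
  obtain ⟨i, hi⟩ := exists_ne a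
  have hbdd : BddAbove (Set.range (mean (perturbed a p))) := (Set.finite_range _).bddAbove
  have : Nonempty (Fin A) := ⟨a⟩
  apply le_antisymm
  · refine ciSup_le fun j => ?_
    rw [mean_perturbed]
    split_ifs
    · exact le_max_left _ _
    · exact le_max_right _ _
  · refine max_le ?_ ?_
    · exact le_of_eq_of_le (by simp [mean_perturbed]) (le_ciSup hbdd a)
    · exact le_of_eq_of_le (by simp [mean_perturbed, hi]) (le_ciSup hbdd i)

theorem regret_perturbed_of_ge (hA : 2 ≤ A) (a : Fin A) (p : I) (hp : 1 / 2 ≤ (p : ℝ))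
    (π : Strategy A) (t : ℕ) (h : Info t) :
    regret (perturbed a p) π t h = (p - 1 / 2) * (t - plays a π t h) := by
  induction t with
  | zero => simp [regret, plays]
  | succ t ih =>
    obtain ⟨h, y⟩ := h
    simp only [regret, plays, ih h, iSup_mean_perturbed hA, max_eq_left hp]
    rw [mean_perturbed]
    push_cast
    split_ifs <;> ring

theorem regret_perturbed_of_le (hA : 2 ≤ A) (a : Fin A) (p : I) (hp : (p : ℝ) ≤ 1 / 2)
    (π : Strategy A) (t : ℕ) (h : Info t) :
    regret (perturbed a p) π t h = (1 / 2 - p) * plays a π t h := by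
  induction t with
  | zero => simp [regret, plays]
  | succ t ih =>
    obtain ⟨h, y⟩ := h
    simp only [regret, plays, ih h, iSup_mean_perturbed hA, max_eq_right hp]
    rw [mean_perturbed]
    split_ifs <;> ring

theorem expectedRegret_nonneg (ν : Instance A) (π : Strategy A) (T : ℕ) :
    0 ≤ expectedRegret ν π T := by
  refine integral_nonneg fun h => ?_
  induction T with
  | zero => exact le_rfl
  | succ t ih =>
    obtain ⟨h, y⟩ := h
    exact add_nonneg (ih h) (sub_nonneg.2 (le_ciSup (Set.finite_range _).bddAbove _))

/-! ### Likelihood ratio and change of measure -/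

/-- The log-likelihood ratio of one observation, between arm `a` being Bernoulli with parameter `p`
and being Bernoulli with parameter `1/2`. -/
noncomputable def logRatioStep (a : Fin A) (p : I) (i : Fin A × Bool) (y : I × I) : ℝ :=
  if i = (a, true) then Real.log (1 + (2 * p - 1) * (2 * y.1 - 1)) else 0

/-- The log-likelihood ratio of the information after `t` rounds between the instances
`perturbed a p` and `fair`. -/
noncomputable def logRatio (a : Fin A) (p : I) (π : Strategy A) : (t : ℕ) → Info t → ℝ
  | 0, _ => 0
  | t + 1, (h, y) => logRatio a p π t h + logRatioStep a p (π.arm t h, π.query t h) y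

theorem measurable_logRatioStep (a : Fin A) (p : I) :
    Measurable fun z : (Fin A × Bool) × (I × I) => logRatioStep a p z.1 z.2 := by
  unfold logRatioStep
  refine Measurable.ite (measurable_fst (MeasurableSet.singleton _)) ?_ measurable_const
  fun_prop

theorem measurable_logRatio (a : Fin A) (p : I) (π : Strategy A) (t : ℕ) :
    Measurable (logRatio a p π t) := by
  induction t with
  | zero => exact measurable_const
  | succ t ih =>
    have h : Measurable fun z : Info t × (I × I) =>
        logRatio a p π t z.1 + logRatioStep a p (π.arm t z.1, π.query t z.1) z.2 :=
      (ih.comp measurable_fst).add ((measurable_logRatioStep a p).comp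
        ((((π.measurable_arm t).prodMk (π.measurable_query t)).comp measurable_fst).prodMk
          measurable_snd))
    exact h

/-- The affine expression under the logarithm interpolates the likelihood ratios `2 * p` at `1` and
`2 * (1 - p)` at `0`. It stays in `[1/2, 3/2]` for every observation, on or off the support, so
integrability needs no almost-sure argument. -/
theorem abs_logRatioStep_le (a : Fin A) (p : I) (hp0 : 1 / 4 ≤ (p : ℝ)) (hp1 : (p : ℝ) ≤ 3 / 4)
    (i : Fin A × Bool) (y : I × I) : |logRatioStep a p i y| ≤ 1 := by
  unfold logRatioStep
  split_ifs
  · have h0 := y.1.2.1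
    have h1 := y.1.2.2
    have hl : 1 / 2 ≤ 1 + (2 * (p : ℝ) - 1) * (2 * (y.1 : ℝ) - 1) := by nlinarith
    have hu : 1 + (2 * (p : ℝ) - 1) * (2 * (y.1 : ℝ) - 1) ≤ 3 / 2 := by nlinarith
    set x := 1 + (2 * (p : ℝ) - 1) * (2 * (y.1 : ℝ) - 1)
    have hx : 0 < x := by linarith
    rw [abs_le]
    constructor
    · have := Real.one_sub_inv_le_log_of_pos hx
      have h2 : x⁻¹ ≤ 2 := by
        rw [inv_le_comm₀ hx two_pos]; linarith
      linarith
    · linarith [Real.log_le_sub_one_of_pos hx]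
  · simp

theorem abs_logRatio_le (a : Fin A) (p : I) (hp0 : 1 / 4 ≤ (p : ℝ)) (hp1 : (p : ℝ) ≤ 3 / 4)
    (π : Strategy A) (t : ℕ) (h : Info t) : |logRatio a p π t h| ≤ t := by
  induction t with
  | zero => simp [logRatio]
  | succ t ih =>
    obtain ⟨h, y⟩ := h
    push_cast
    exact (abs_add_le _ _).trans (add_le_add (ih h) (abs_logRatioStep_le a p hp0 hp1 _ _))

theorem feedback_apply (ν : Instance A) (i : Fin A × Bool) :
    feedback ν i = ((ν i.1 : Measure I).map (observe i.2)).prod (volume : Measure I) := rfl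

theorem map_observe_true (μ : Measure I) : μ.map (observe true) = μ := Measure.map_id

theorem map_observe_false (μ : ProbabilityMeasure I) :
    (μ : Measure I).map (observe false) = Measure.dirac 0 := by
  have : observe false = fun _ => 0 := rfl
  rw [this, Measure.map_const]
  simp

/-- When `a` is queried, the two atoms are compared. In all other cases the two feedback laws
coincide; in particular an unqueried round always shows `0`. -/
theorem lintegral_feedback_perturbed (a : Fin A) (p : I) (hp0 : 0 < (p : ℝ)) (hp1 : (p : ℝ) < 1)
    (i : Fin A × Bool) (f : I × I → ENNReal) (hf : Measurable f) :
    ∫⁻ y, f y ∂(feedback (perturbed a p) i) =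
      ∫⁻ y, f y * ENNReal.ofReal (Real.exp (logRatioStep a p i y)) ∂(feedback fair i) := by
  by_cases hi : i = (a, true)
  · subst hi
    have hg : Measurable fun y : I × I =>
        f y * ENNReal.ofReal (Real.exp (logRatioStep a p (a, true) y)) :=
      hf.mul (((measurable_logRatioStep a p).comp
        (measurable_const.prodMk measurable_id)).exp.ennreal_ofReal)
    rw [feedback_apply, feedback_apply, map_observe_true, map_observe_true,
      lintegral_prod _ hf.aemeasurable, lintegral_prod _ hg.aemeasurable]
    simp only [perturbed, fair, if_true, lintegral_bernoulli]
    have e1 : ∀ y : I, Real.exp (logRatioStep a p (a, true) (1, y)) = 2 * p := fun y => by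
      simp only [logRatioStep, if_true, Set.Icc.coe_one]
      rw [Real.exp_log] <;> linarith
    have e0 : ∀ y : I, Real.exp (logRatioStep a p (a, true) (0, y)) = 2 * (1 - p) := fun y => by
      simp only [logRatioStep, if_true, Set.Icc.coe_zero]
      rw [Real.exp_log] <;> linarith
    simp only [e1, e0]
    rw [lintegral_mul_const' _ _ ENNReal.ofReal_ne_top,
      lintegral_mul_const' _ _ ENNReal.ofReal_ne_top, mul_comm (∫⁻ y : I, f (1, y)),
      mul_comm (∫⁻ y : I, f (0, y)), ← mul_assoc, ← mul_assoc, ← ENNReal.ofReal_mul half.2.1,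
      ← ENNReal.ofReal_mul (sub_nonneg.2 half.2.2)]
    congr 3 <;> simp only [half] <;> ring_nf
  · have h : feedback (perturbed a p) i = feedback fair i := by
      rw [feedback_apply, feedback_apply]
      obtain ⟨j, q⟩ := i
      cases q
      · rw [map_observe_false, map_observe_false]
      · have : j ≠ a := fun h => hi (by rw [h])
        simp [perturbed, fair, this]
    simp [logRatioStep, hi, h]

/-- The strategy is the same on both instances, so only the feedback densities multiply up along the
rounds. -/
theorem law_perturbed (a : Fin A) (p : I) (hp0 : 0 < (p : ℝ)) (hp1 : (p : ℝ) < 1)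
    (π : Strategy A) (t : ℕ) :
    law (perturbed a p) π t = (law fair π t).withDensity
      fun h => ENNReal.ofReal (Real.exp (logRatio a p π t h)) := by
  induction t with
  | zero =>
    simp only [logRatio, Real.exp_zero, ENNReal.ofReal_one]
    exact withDensity_one.symm
  | succ t ih =>
    have hm := fun t => ((measurable_logRatio a p π t).exp).ennreal_ofReal
    refine Measure.ext_of_lintegral _ fun f hf => ?_
    rw [lintegral_withDensity_eq_lintegral_mul _ (hm (t + 1)) hf]
    have hL : ∫⁻ z, f z ∂(law (perturbed a p) π (t + 1)) =
        ∫⁻ h, ∫⁻ y, f (h, y) ∂(step (perturbed a p) π t h) ∂(law (perturbed a p) π t) :=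
      Measure.lintegral_compProd (μ := law (perturbed a p) π t) (κ := step (perturbed a p) π t) hf
    have hR : ∫⁻ z, ((fun h => ENNReal.ofReal (Real.exp (logRatio a p π (t + 1) h))) * f) z
          ∂(law fair π (t + 1)) =
        ∫⁻ h, ∫⁻ y, ENNReal.ofReal (Real.exp (logRatio a p π t h +
            logRatioStep a p (π.arm t h, π.query t h) y)) * f (h, y)
          ∂(step fair π t h) ∂(law fair π t) :=
      Measure.lintegral_compProd (μ := law fair π t) (κ := step fair π t) ((hm (t + 1)).mul hf)
    have hF : Measurable fun h : Info t => ∫⁻ y, f (h, y) ∂(step (perturbed a p) π t h) :=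
      Measurable.lintegral_kernel_prod_right' (κ := step (perturbed a p) π t) hf
    rw [hL, hR, ih, lintegral_withDensity_eq_lintegral_mul _ (hm t) hF]
    refine lintegral_congr fun h => ?_
    have hfh : Measurable fun y => f (h, y) :=
      Measurable.comp (g := f) hf (measurable_prodMk_left (x := h))
    have hstep : ∀ ν : Instance A, step ν π t h = feedback ν (π.arm t h, π.query t h) :=
      fun _ => rfl
    simp only [Pi.mul_apply, hstep]
    rw [lintegral_feedback_perturbed a p hp0 hp1 _ _ hfh,
      ← lintegral_const_mul' _ _ ENNReal.ofReal_ne_top]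
    refine lintegral_congr fun y => ?_
    rw [Real.exp_add, ENNReal.ofReal_mul (Real.exp_pos _).le]
    ring

theorem integral_law_perturbed (a : Fin A) (p : I) (hp0 : 0 < (p : ℝ)) (hp1 : (p : ℝ) < 1)
    (π : Strategy A) (t : ℕ) (f : Info t → ℝ) :
    ∫ h, f h ∂(law (perturbed a p) π t) =
      ∫ h, Real.exp (logRatio a p π t h) * f h ∂(law fair π t) := by
  rw [law_perturbed a p hp0 hp1,
    integral_withDensity_eq_integral_toReal_smul
      ((measurable_logRatio a p π t).exp).ennreal_ofReal (by simp)]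
  simp [ENNReal.toReal_ofReal (Real.exp_pos _).le]

/-! ### Divergence bound -/

/-- With `d = (2 * p - 1) ^ 2`, a query of `a` contributes `log (1 - d) / 2`, and `log (1 - d) ≥ 1 -
1 / (1 - d) ≥ -2 * d` for `d ≤ 1 / 2`. -/
theorem integral_logRatioStep_ge (a : Fin A) (p : I) (hp0 : 1 / 4 ≤ (p : ℝ))
    (hp1 : (p : ℝ) ≤ 3 / 4) (i : Fin A × Bool) :
    -((2 * (p : ℝ) - 1) ^ 2 * if i = (a, true) then 1 else 0) ≤
      ∫ y, logRatioStep a p i y ∂(feedback fair i) := by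
  by_cases hi : i = (a, true)
  · subst hi
    have hint : Integrable (logRatioStep a p (a, true)) (feedback fair (a, true)) :=
      Integrable.of_bound ((measurable_logRatioStep a p).comp
        (measurable_const.prodMk measurable_id)).aestronglyMeasurable 1
        (Filter.Eventually.of_forall fun y => abs_logRatioStep_le a p hp0 hp1 _ y)
    rw [feedback_apply, map_observe_true] at *
    rw [integral_prod _ hint]
    simp only [fair, integral_bernoulli, logRatioStep, if_true, integral_const, Set.Icc.coe_one,
      Set.Icc.coe_zero, half, probReal_univ, one_smul]
    have h1 : 0 < 1 + (2 * (p : ℝ) - 1) * (2 * 1 - 1) := by linarith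
    have h0 : 0 < 1 + (2 * (p : ℝ) - 1) * (2 * 0 - 1) := by linarith
    have hprod : (1 + (2 * (p : ℝ) - 1) * (2 * 1 - 1)) * (1 + (2 * (p : ℝ) - 1) * (2 * 0 - 1)) =
        1 - (2 * (p : ℝ) - 1) ^ 2 := by ring
    have hb : (2 * (p : ℝ) - 1) ^ 2 ≤ 1 / 2 := by nlinarith
    have hlog := Real.log_mul h1.ne' h0.ne'
    rw [hprod] at hlog
    generalize Real.log (1 + (2 * (p : ℝ) - 1) * (2 * 1 - 1)) = l1 at *
    generalize Real.log (1 + (2 * (p : ℝ) - 1) * (2 * 0 - 1)) = l0 at *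
    have hx : 0 < 1 - (2 * (p : ℝ) - 1) ^ 2 := by linarith
    have hge := Real.one_sub_inv_le_log_of_pos hx
    have hinv : (1 - (2 * (p : ℝ) - 1) ^ 2)⁻¹ ≤ 1 + 2 * (2 * (p : ℝ) - 1) ^ 2 := by
      rw [inv_le_iff_one_le_mul₀ hx]
      nlinarith [mul_nonneg (sq_nonneg (2 * (p : ℝ) - 1)) (sub_nonneg.2 hb)]
    linarith
  · simp [logRatioStep, hi]

theorem integrable_logRatio (ν : Instance A) (a : Fin A) (p : I) (hp0 : 1 / 4 ≤ (p : ℝ))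
    (hp1 : (p : ℝ) ≤ 3 / 4) (π : Strategy A) (t : ℕ) :
    Integrable (logRatio a p π t) (law ν π t) :=
  Integrable.of_bound (measurable_logRatio a p π t).aestronglyMeasurable t
    (Filter.Eventually.of_forall fun h => abs_logRatio_le a p hp0 hp1 π t h)

/-- The divergence decomposition, as an inequality. -/
theorem integral_logRatio_ge (a : Fin A) (p : I) (hp0 : 1 / 4 ≤ (p : ℝ)) (hp1 : (p : ℝ) ≤ 3 / 4)
    (π : Strategy A) (t : ℕ) :
    -((2 * (p : ℝ) - 1) ^ 2 * ∫ h, queries a π t h ∂(law fair π t)) ≤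
      ∫ h, logRatio a p π t h ∂(law fair π t) := by
  have hint : ∀ t, Integrable (fun h => logRatio a p π t h + (2 * (p : ℝ) - 1) ^ 2 *
      queries a π t h) (law fair π t) := fun t =>
    (integrable_logRatio fair a p hp0 hp1 π t).add ((integrable_queries fair a π t).const_mul _)
  -- The compensated log-ratio is a submartingale under `fair` that starts at `0`.
  suffices 0 ≤ ∫ h, (logRatio a p π t h + (2 * (p : ℝ) - 1) ^ 2 * queries a π t h)
      ∂(law fair π t) by
    rw [integral_add (integrable_logRatio fair a p hp0 hp1 π t)
      ((integrable_queries fair a π t).const_mul _), integral_const_mul] at this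
    linarith
  induction t with
  | zero => simp [logRatio, queries]
  | succ t ih =>
    refine ih.trans ?_
    have h := Measure.integral_compProd (μ := law fair π t) (κ := step fair π t) (hint (t + 1))
    refine le_of_le_of_eq ?_ h.symm
    refine integral_mono (hint t) (Integrable.integral_compProd (hint (t + 1))) fun h => ?_
    have hs : Integrable (logRatioStep a p (π.arm t h, π.query t h)) (step fair π t h) :=
      Integrable.of_bound ((measurable_logRatioStep a p).comp
        (measurable_const.prodMk measurable_id)).aestronglyMeasurable 1
        (Filter.Eventually.of_forall fun y => abs_logRatioStep_le a p hp0 hp1 _ y)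
    have hg := integral_logRatioStep_ge a p hp0 hp1 (π.arm t h, π.query t h)
    have e : ∀ y : I × I, logRatio a p π (t + 1) (h, y) + (2 * (p : ℝ) - 1) ^ 2 *
        queries a π (t + 1) (h, y) = logRatioStep a p (π.arm t h, π.query t h) y +
          (logRatio a p π t h + (2 * (p : ℝ) - 1) ^ 2 * (queries a π t h +
            if (π.arm t h, π.query t h) = (a, true) then 1 else 0)) := fun y => by
      simp only [logRatio, queries]; ring
    have hI : ∫ y, (logRatio a p π (t + 1) (h, y) + (2 * (p : ℝ) - 1) ^ 2 *
        queries a π (t + 1) (h, y)) ∂(step fair π t h) =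
        ∫ y, logRatioStep a p (π.arm t h, π.query t h) y
          ∂(feedback fair (π.arm t h, π.query t h)) +
          (logRatio a p π t h + (2 * (p : ℝ) - 1) ^ 2 * (queries a π t h +
            if (π.arm t h, π.query t h) = (a, true) then 1 else 0)) := by
      simp only [e]
      rw [integral_add hs (integrable_const _), integral_const, probReal_univ, one_smul]
      rfl
    refine le_of_le_of_eq ?_ hI.symm
    rw [mul_add]
    linarith

/-! ### From divergence to total variation -/

/-- A pointwise, linearized Pinsker inequality: the right side is `(exp x + 1) / 16 + 8 * (exp x - 1
- x)`. With `r = exp (x / 2)`, apply AM-GM to `|r - 1| * (r + 1)`, then use `(r + 1) ^ 2 ≤ 2 * (r ^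
2 + 1)` and `r ≥ 1 + x / 2`. -/
theorem abs_exp_sub_one_le (x : ℝ) :
    |Real.exp x - 1| ≤ 129 / 16 * Real.exp x - 127 / 16 - 8 * x := by
  have hx : Real.exp x = Real.exp (x / 2) ^ 2 := by
    rw [← Real.exp_nat_mul]; congr 1; push_cast; ring
  have h := Real.add_one_le_exp (x / 2)
  rw [hx]
  set r := Real.exp (x / 2)
  rw [abs_le]
  constructor
  · nlinarith [sq_nonneg (16 * (r - 1) + (r + 1)), sq_nonneg (r - 1)]
  · nlinarith [sq_nonneg (16 * (r - 1) - (r + 1)), sq_nonneg (r - 1)]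

theorem integrable_exp_logRatio (ν : Instance A) (a : Fin A) (p : I) (hp0 : 1 / 4 ≤ (p : ℝ))
    (hp1 : (p : ℝ) ≤ 3 / 4) (π : Strategy A) (t : ℕ) :
    Integrable (fun h => Real.exp (logRatio a p π t h)) (law ν π t) :=
  Integrable.of_bound (measurable_logRatio a p π t).exp.aestronglyMeasurable (Real.exp t)
    (Filter.Eventually.of_forall fun h => by
      rw [Real.norm_eq_abs, abs_of_pos (Real.exp_pos _)]
      exact Real.exp_le_exp.2 (le_of_abs_le (abs_logRatio_le a p hp0 hp1 π t h)))

/-- The likelihood ratio has mean `1`, so integrating `abs_exp_sub_one_le` leaves `1 / 8` plus `8`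
times the divergence. -/
theorem integral_abs_exp_logRatio_sub_one_le (a : Fin A) (p : I) (hp0 : 1 / 4 ≤ (p : ℝ))
    (hp1 : (p : ℝ) ≤ 3 / 4) (π : Strategy A) (t : ℕ) :
    ∫ h, |Real.exp (logRatio a p π t h) - 1| ∂(law fair π t) ≤
      1 / 8 + 8 * ((2 * (p : ℝ) - 1) ^ 2 * ∫ h, queries a π t h ∂(law fair π t)) := by
  have hE := integrable_exp_logRatio fair a p hp0 hp1 π t
  have hL := integrable_logRatio fair a p hp0 hp1 π t
  have h1 : ∫ h, Real.exp (logRatio a p π t h) ∂(law fair π t) = 1 := by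
    have := integral_law_perturbed a p (by linarith) (by linarith) π t fun _ => 1
    simpa using this.symm
  have h2 := integral_logRatio_ge a p hp0 hp1 π t
  have hi : Integrable (fun h => 129 / 16 * Real.exp (logRatio a p π t h) - 127 / 16)
      (law fair π t) := (hE.const_mul _).sub (integrable_const _)
  calc ∫ h, |Real.exp (logRatio a p π t h) - 1| ∂(law fair π t)
      ≤ ∫ h, (129 / 16 * Real.exp (logRatio a p π t h) - 127 / 16 - 8 * logRatio a p π t h)
          ∂(law fair π t) :=
        integral_mono (hE.sub (integrable_const _)).abs (hi.sub (hL.const_mul _))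
          fun h => abs_exp_sub_one_le _
    _ = 129 / 16 - 127 / 16 - 8 * ∫ h, logRatio a p π t h ∂(law fair π t) := by
        rw [integral_sub hi (hL.const_mul _), integral_sub (hE.const_mul _) (integrable_const _),
          integral_const_mul, integral_const_mul, h1]
        simp
    _ ≤ _ := by linarith

/-- If arm `a` is rarely queried on the instance `fair`, then perturbing it hardly changes the
number of times it is played. -/
theorem abs_integral_plays_sub_le (a : Fin A) (p : I) (hp0 : 1 / 4 ≤ (p : ℝ))
    (hp1 : (p : ℝ) ≤ 3 / 4) (π : Strategy A) (T : ℕ)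
    (hq : (2 * (p : ℝ) - 1) ^ 2 * ∫ h, queries a π T h ∂(law fair π T) ≤ 1 / 64) :
    |∫ h, plays a π T h ∂(law (perturbed a p) π T) - ∫ h, plays a π T h ∂(law fair π T)| ≤
      T / 4 := by
  have hE := integrable_exp_logRatio fair a p hp0 hp1 π T
  have hN := integrable_plays fair a π T
  have hb : ∀ h, ‖plays a π T h‖ ≤ T := fun h => by
    rw [Real.norm_eq_abs, abs_of_nonneg (plays_mem a π T h).1]
    exact (plays_mem a π T h).2
  have hEN : Integrable (fun h => Real.exp (logRatio a p π T h) * plays a π T h)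
      (law fair π T) := hE.mul_bdd hN.aestronglyMeasurable (Filter.Eventually.of_forall hb)
  rw [integral_law_perturbed a p (by linarith) (by linarith), ← integral_sub hEN hN]
  calc |∫ h, (Real.exp (logRatio a p π T h) * plays a π T h - plays a π T h) ∂(law fair π T)|
      ≤ ∫ h, |Real.exp (logRatio a p π T h) * plays a π T h - plays a π T h| ∂(law fair π T) :=
        abs_integral_le_integral_abs
    _ ≤ ∫ h, T * |Real.exp (logRatio a p π T h) - 1| ∂(law fair π T) := by
        refine integral_mono (hEN.sub hN).abs
          ((hE.sub (integrable_const _)).abs.const_mul _) fun h => ?_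
        have e : Real.exp (logRatio a p π T h) * plays a π T h - plays a π T h =
            plays a π T h * (Real.exp (logRatio a p π T h) - 1) := by ring
        simp only [e, abs_mul]
        exact mul_le_mul_of_nonneg_right (hb h) (abs_nonneg _)
    _ = T * ∫ h, |Real.exp (logRatio a p π T h) - 1| ∂(law fair π T) := integral_const_mul _ _
    _ ≤ T * (1 / 4) := by
        refine mul_le_mul_of_nonneg_left ?_ (Nat.cast_nonneg _)
        linarith [integral_abs_exp_logRatio_sub_one_le a p hp0 hp1 π T]
    _ = T / 4 := by ring

/-! ### Choice of the hard instance -/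

theorem expectedRegret_perturbed_of_ge (hA : 2 ≤ A) (a : Fin A) (p : I) (hp : 1 / 2 ≤ (p : ℝ))
    (π : Strategy A) (T : ℕ) : expectedRegret (perturbed a p) π T =
      (p - 1 / 2) * (T - ∫ h, plays a π T h ∂(law (perturbed a p) π T)) := by
  simp_rw [expectedRegret, regret_perturbed_of_ge hA a p hp]
  rw [integral_const_mul, integral_sub (integrable_const _) (integrable_plays _ a π T)]
  simp

theorem expectedRegret_perturbed_of_le (hA : 2 ≤ A) (a : Fin A) (p : I) (hp : (p : ℝ) ≤ 1 / 2)
    (π : Strategy A) (T : ℕ) : expectedRegret (perturbed a p) π T =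
      (1 / 2 - p) * ∫ h, plays a π T h ∂(law (perturbed a p) π T) := by
  simp_rw [expectedRegret, regret_perturbed_of_le hA a p hp]
  rw [integral_const_mul]

theorem exists_expectedRegret_ge (hA : 2 ≤ A) (T : ℕ) (c : Fin A → ℝ) (hc : ∀ a, 0 ≤ c a) (B : ℝ)
    (π : Strategy A) (hB : expectedQueryCost c fair π T ≤ B) (hC : 0 < ∑ a, c a) (s : ℝ)
    (hs0 : 0 ≤ s) (hs1 : s ≤ 1) (hs : s ^ 2 * B ≤ ∑ a, c a) :
    ∃ ν : Instance A, s * T / 64 ≤ expectedRegret ν π T := by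
  obtain ⟨a, ha⟩ : ∃ a, s ^ 2 * ∫ h, queries a π T h ∂(law fair π T) ≤ 1 := by
    by_contra! hcon
    rw [expectedQueryCost_eq_sum] at hB
    have hlt : ∑ a, c a < ∑ a, c a * (s ^ 2 * ∫ h, queries a π T h ∂(law fair π T)) := by
      -- An arm of positive cost makes the weighted inequality strict.
      obtain ⟨a, -, ha⟩ := Finset.exists_lt_of_sum_lt (s := Finset.univ) (f := fun _ => (0 : ℝ))
        (g := c) (by simpa using hC)
      refine Finset.sum_lt_sum (fun i _ => le_mul_of_one_le_right (hc i) (hcon i).le)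
        ⟨a, Finset.mem_univ _, lt_mul_of_one_lt_right ha (hcon a)⟩
    have he : ∑ a, c a * (s ^ 2 * ∫ h, queries a π T h ∂(law fair π T)) =
        s ^ 2 * ∑ a, c a * ∫ h, queries a π T h ∂(law fair π T) := by
      rw [Finset.mul_sum]
      exact Finset.sum_congr rfl fun a _ => by ring
    have := mul_le_mul_of_nonneg_left hB (sq_nonneg s)
    linarith
  have hT : (0 : ℝ) ≤ T := Nat.cast_nonneg T
  rcases le_total (∫ h, plays a π T h ∂(law fair π T)) (T / 2) with hN | hN
  -- Here `(2 * p - 1) ^ 2 = s ^ 2 / 64`, exactly what the query threshold `1 / 64` allows; `a` is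
  -- still played at most `3 * T / 4` times in expectation.
  · let p : I := ⟨1 / 2 + s / 16, by linarith, by linarith⟩
    have hp : (p : ℝ) = 1 / 2 + s / 16 := rfl
    have h := abs_integral_plays_sub_le a p (by linarith) (by linarith) π T (by
      rw [hp]; ring_nf at ha ⊢; linarith)
    refine ⟨perturbed a p, ?_⟩
    rw [expectedRegret_perturbed_of_ge hA a p (by linarith), hp]
    nlinarith [(abs_le.1 h).2]
  · let p : I := ⟨1 / 2 - s / 16, by linarith, by linarith⟩
    have hp : (p : ℝ) = 1 / 2 - s / 16 := rfl
    have h := abs_integral_plays_sub_le a p (by linarith) (by linarith) π T (by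
      rw [hp]; ring_nf at ha ⊢; linarith)
    refine ⟨perturbed a p, ?_⟩
    rw [expectedRegret_perturbed_of_le hA a p (by linarith), hp]
    nlinarith [(abs_le.1 h).1]

end BudgetedBandit

theorem mainTheorem10 (A : ℕ) (hA : 2 ≤ A) (T : ℕ) (c : Fin A → ℝ) (hc : ∀ a, 0 ≤ c a) (B : ℝ)
    (π : BudgetedBandit.Strategy A)
    (hB : ∀ ν : BudgetedBandit.Instance A, BudgetedBandit.expectedQueryCost c ν π T ≤ B) :
    ∃ ν : BudgetedBandit.Instance A,
      (0 < B →
        1 / 140 * min ((T : ℝ) * √((∑ a, c a) / (B * (1 + Real.log (A : ℝ))))) (T : ℝ) ≤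
          BudgetedBandit.expectedRegret ν π T) ∧
      (B = 0 → 0 < ∑ a, c a →
        1 / 140 * (T : ℝ) ≤ BudgetedBandit.expectedRegret ν π T) := by
  have hT : (0 : ℝ) ≤ T := Nat.cast_nonneg T
  rcases (Finset.sum_nonneg fun a _ => hc a : 0 ≤ ∑ a, c a).eq_or_lt with hC | hC
  · refine ⟨BudgetedBandit.fair, fun _ => ?_, fun _ h => absurd h (by rw [← hC]; exact lt_irrefl _)⟩
    rw [← hC]
    simpa [hT] using BudgetedBandit.expectedRegret_nonneg BudgetedBandit.fair π T
  rcases lt_trichotomy B 0 with hB0 | rfl | hB0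
  · exact ⟨BudgetedBandit.fair, fun h => absurd h hB0.not_gt, fun h => absurd h hB0.ne⟩
  -- A zero budget puts no constraint on `s`, so the largest value `1` is taken.
  · obtain ⟨ν, hν⟩ := BudgetedBandit.exists_expectedRegret_ge hA T c hc 0 π (hB _) hC 1 zero_le_one
      le_rfl (by simpa using hC.le)
    exact ⟨ν, fun h => absurd h (lt_irrefl _), fun _ _ => by linarith⟩
  · have hlog : 0 ≤ Real.log (A : ℝ) := Real.log_natCast_nonneg A
    set x := (∑ a, c a) / (B * (1 + Real.log (A : ℝ))) with hx
    have hx0 : 0 ≤ x := by positivity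
    have hm0 : 0 ≤ min √x 1 := le_min (Real.sqrt_nonneg _) zero_le_one
    have hs : min √x 1 ^ 2 * B ≤ ∑ a, c a := by
      calc min √x 1 ^ 2 * B ≤ √x ^ 2 * B := by gcongr; exact min_le_left _ _
        _ = x * B := by rw [Real.sq_sqrt hx0]
        _ = (∑ a, c a) / (1 + Real.log (A : ℝ)) := by rw [hx]; field_simp
        -- The logarithmic factor is simply discarded.
        _ ≤ ∑ a, c a := div_le_self hC.le (by linarith)
    obtain ⟨ν, hν⟩ := BudgetedBandit.exists_expectedRegret_ge hA T c hc B π (hB _) hC _ hm0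
      (min_le_right _ _) hs
    refine ⟨ν, fun _ => ?_, fun h => absurd h hB0.ne'⟩
    have he : min ((T : ℝ) * √x) T = min √x 1 * T := by
      rw [min_mul_of_nonneg _ _ hT, mul_comm, one_mul]
    rw [he]
    have := mul_nonneg hm0 hT
    linarith
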